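/- Let $M$ be a non-empty Hermitian manifold of complex dimension $n\ge 2$, that is, a smooth (Hausdorff) manifold of real dimension $2n$ without boundary, with a smooth Riemannian metric $h$ and a smooth field $J$ of endomorphisms of the tangent spaces such that $J^2=-\mathrm{Id}$, $h(JX,JY)=h(X,Y)$, and the Nijenhuis tensor $N(X,Y)=[JX,JY]-J[JX,Y]-J[X,JY]-[X,Y]$ vanishes (i.e. $J$ is integrable). Let $D$ be its Chern connection: the unique connection on $TM$ for which $h$ and $J$ are parallel and the $(1,1)$-part of the torsion $T$ vanishes, i.e. $T(X,Y)+T(JX,JY)=0$. Let $R(X,Y)=D_{[X,Y]}-[D_X,D_Y]$ be its curvature, and for non-zero tangent vectors $X,Y$ at the same point let $$H^c(X,Y)=\frac{h(R(X,JX)Y,JY)}{\|X\|^2\,\|Y\|^2}$$ be the Hermitian bisectional curvature of $M$ (the holomorphic bisectional curvature of the Chern connection). Then $H^c$ is never a non-zero constant: there is no real number $c\neq 0$ such that $H^c(X,Y)=c$ for all points of $M$ and all non-zero tangent vectors $X,Y$ at that point. -/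

import Mathlib

open Bundle VectorField
open scoped Manifold ContDiff

noncomputable section

namespace HermitianGeometry

variable {E : Type*} [NormedAddCommGroup E] [NormedSpace ℝ E]
  {M : Type*} [TopologicalSpace M] [ChartedSpace E M]

/-- A smooth (globally defined) vector field on the manifold `M` without boundary. -/
def SmoothField [IsManifold 𝓘(ℝ, E) ∞ M] (X : (x : M) → TangentSpace 𝓘(ℝ, E) x) : Prop :=
  ContMDiff 𝓘(ℝ, E) 𝓘(ℝ, E).tangent ∞ (fun x ↦ (⟨x, X x⟩ : TangentBundle 𝓘(ℝ, E) M))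

/-- The vector field `J X`, for a field `J` of endomorphisms of the tangent spaces. -/
def applyField
    (J : (x : M) → TangentSpace 𝓘(ℝ, E) x →L[ℝ] TangentSpace 𝓘(ℝ, E) x)
    (X : (x : M) → TangentSpace 𝓘(ℝ, E) x) : (x : M) → TangentSpace 𝓘(ℝ, E) x :=
  fun x ↦ J x (X x)

/-- The field `J` of endomorphisms of the tangent spaces of `M` and the Riemannian metric of `M`
form a Hermitian structure: `J` is a smooth almost complex structure, orthogonal for the metric
and integrable, i.e. with vanishing Nijenhuis tensor
`N(X, Y) = [JX, JY] - J[JX, Y] - J[X, JY] - [X, Y]`. -/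
structure IsHermitianStructure [IsManifold 𝓘(ℝ, E) ∞ M]
    [RiemannianBundle (fun x : M ↦ TangentSpace 𝓘(ℝ, E) x)]
    (J : (x : M) → TangentSpace 𝓘(ℝ, E) x →L[ℝ] TangentSpace 𝓘(ℝ, E) x) : Prop where
  smooth : ContMDiff 𝓘(ℝ, E) (𝓘(ℝ, E).prod 𝓘(ℝ, E →L[ℝ] E)) ∞
    (fun x ↦ TotalSpace.mk' (E →L[ℝ] E)
      (E := fun x : M ↦ TangentSpace 𝓘(ℝ, E) x →L[ℝ] TangentSpace 𝓘(ℝ, E) x) x (J x))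
  sq_eq_neg : ∀ (x : M) (v : TangentSpace 𝓘(ℝ, E) x), J x (J x v) = -v
  orthogonal : ∀ (x : M) (v w : TangentSpace 𝓘(ℝ, E) x),
    inner ℝ (J x v) (J x w) = inner ℝ v w
  nijenhuis_eq_zero : ∀ X Y : (x : M) → TangentSpace 𝓘(ℝ, E) x,
    SmoothField X → SmoothField Y → ∀ x : M,
      mlieBracket 𝓘(ℝ, E) (applyField J X) (applyField J Y) x
        - J x (mlieBracket 𝓘(ℝ, E) (applyField J X) Y x)
        - J x (mlieBracket 𝓘(ℝ, E) X (applyField J Y) x)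
        - mlieBracket 𝓘(ℝ, E) X Y x = 0

/-- The connection `D` on the tangent bundle is the Chern connection of the almost Hermitian
manifold `M`: it is a smooth connection for which the metric and the almost complex structure `J`
are parallel, and the `(1,1)`-part `(T(u, v) + T(Ju, Jv)) / 2` of its torsion `T` vanishes.
(`D Y x u` is the covariant derivative `(D_u Y)(x)`.) -/
structure IsChernConnection [FiniteDimensional ℝ E] [IsManifold 𝓘(ℝ, E) ∞ M]
    [RiemannianBundle (fun x : M ↦ TangentSpace 𝓘(ℝ, E) x)]
    [IsContMDiffRiemannianBundle 𝓘(ℝ, E) ∞ E (fun x : M ↦ TangentSpace 𝓘(ℝ, E) x)]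
    (J : (x : M) → TangentSpace 𝓘(ℝ, E) x →L[ℝ] TangentSpace 𝓘(ℝ, E) x)
    (D : CovariantDerivative 𝓘(ℝ, E) E (fun x : M ↦ TangentSpace 𝓘(ℝ, E) x)) : Prop where
  smooth : D.ContMDiffCovariantDerivative ∞
  metric_parallel : ∀ Y Z : (x : M) → TangentSpace 𝓘(ℝ, E) x, SmoothField Y → SmoothField Z →
    ∀ (x : M) (u : TangentSpace 𝓘(ℝ, E) x),
      mvfderiv 𝓘(ℝ, E) (fun y ↦ inner ℝ (Y y) (Z y)) x u
        = inner ℝ (D Y x u) (Z x) + inner ℝ (Y x) (D Z x u)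
  complex_parallel : ∀ Y : (x : M) → TangentSpace 𝓘(ℝ, E) x, SmoothField Y →
    ∀ (x : M) (u : TangentSpace 𝓘(ℝ, E) x), D (applyField J Y) x u = J x (D Y x u)
  torsion_one_one : ∀ (x : M) (u v : TangentSpace 𝓘(ℝ, E) x),
    D.torsion x u v + D.torsion x (J x u) (J x v) = 0

/-- The curvature `R(X, Y)Z = D_{[X, Y]} Z - (D_X D_Y Z - D_Y D_X Z)` of a connection `D` on the
tangent bundle. -/
def curvature [IsManifold 𝓘(ℝ, E) ∞ M]
    (D : CovariantDerivative 𝓘(ℝ, E) E (fun x : M ↦ TangentSpace 𝓘(ℝ, E) x))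
    (X Y Z : (x : M) → TangentSpace 𝓘(ℝ, E) x) : (x : M) → TangentSpace 𝓘(ℝ, E) x :=
  fun x ↦ D Z x (mlieBracket 𝓘(ℝ, E) X Y x)
    - (D (fun y ↦ D Z y (Y y)) x (X x) - D (fun y ↦ D Z y (X y)) x (Y x))

/-- The holomorphic bisectional curvature `⟨R(X, JX)Y, JY⟩ / (‖X‖² ‖Y‖²)` of a connection `D`,
at a point `x` where the smooth vector fields `X` and `Y` do not vanish. As `R` is a tensor, it
depends only on the tangent vectors `X x` and `Y x`. -/
def bisectionalCurvature [IsManifold 𝓘(ℝ, E) ∞ M]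
    [RiemannianBundle (fun x : M ↦ TangentSpace 𝓘(ℝ, E) x)]
    (J : (x : M) → TangentSpace 𝓘(ℝ, E) x →L[ℝ] TangentSpace 𝓘(ℝ, E) x)
    (D : CovariantDerivative 𝓘(ℝ, E) E (fun x : M ↦ TangentSpace 𝓘(ℝ, E) x))
    (X Y : (x : M) → TangentSpace 𝓘(ℝ, E) x) (x : M) : ℝ :=
  inner ℝ (curvature D X (applyField J X) Y x) (J x (Y x)) / (‖X x‖ ^ 2 * ‖Y x‖ ^ 2)

/-- The Hermitian bisectional curvature is constant, equal to `c`: the bisectional curvature of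
the Chern connection `D` has the value `c` on all pairs of non-zero tangent vectors at all points. -/
def HasConstantBisectionalCurvature [IsManifold 𝓘(ℝ, E) ∞ M]
    [RiemannianBundle (fun x : M ↦ TangentSpace 𝓘(ℝ, E) x)]
    (J : (x : M) → TangentSpace 𝓘(ℝ, E) x →L[ℝ] TangentSpace 𝓘(ℝ, E) x)
    (D : CovariantDerivative 𝓘(ℝ, E) E (fun x : M ↦ TangentSpace 𝓘(ℝ, E) x)) (c : ℝ) : Prop :=
  ∀ X Y : (x : M) → TangentSpace 𝓘(ℝ, E) x, SmoothField X → SmoothField Y →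
    ∀ x : M, X x ≠ 0 → Y x ≠ 0 → bisectionalCurvature J D X Y x = c

end HermitianGeometry

end

set_option linter.unusedSectionVars false

noncomputable section

namespace HermitianGeometry

/-! ### Algebra of a connection on a module of vector fields -/

section Algebra

variable {V : Type*} [AddCommGroup V]

/-! Write ω = g(J·, ·) and T for the torsion. Integrability and the vanishing (1,1)-part make T
complex linear (`tors_J_left`). The first Bianchi identity then makes the curvature of type (1,1)
(`inner_curv_J_J`), so constant bisectional curvature polarises to R = c ω ⊗ J (`inner_curv_eq`). As
g and J are parallel, the second Bianchi identity reduces to c dω = 0, and for c ≠ 0 this kills T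
(`inner_J_tors_eq_zero`): M is Kähler. But without torsion, the first Bianchi identity on X, JX, Z,
with Z orthogonal to X and JX, leaves c‖X‖²‖Z‖² = 0 (`eq_zero_of_inner_curv_eq`).

The algebra takes place in the real vector space of global smooth fields, with g the inner product
at one point; tensoriality of the curvature is not needed. Facts that differentiate functions
(skewness of R, the derivative of ω ⊗ J) enter it as hypotheses and are proved for fields
afterwards. -/

/-- A quadratic form that vanishes outside a proper subgroup vanishes everywhere. -/
lemma diag_eq_zero_of_forall_notMem {f : V → V → ℝ} (hl : ∀ u v w, f (u + v) w = f u w + f v w)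
    (hr : ∀ u v w, f u (v + w) = f u v + f u w) {S : AddSubgroup V} {v₀ : V} (hv₀ : v₀ ∉ S)
    (h : ∀ v ∉ S, f v v = 0) (v : V) : f v v = 0 := by
  by_cases hv : v ∈ S
  -- The vectors v₀ and v₀ ± v lie outside S, so the parallelogram law gives f v v = 0.
  · have h₀ := h v₀ hv₀
    have h₁ := h (v₀ + v) (fun hs ↦ hv₀ ((S.add_mem_cancel_right hv).1 hs))
    have h₂ := h (v₀ - v) (fun hs ↦ hv₀ (by simpa using S.add_mem hs hv))
    have h₃ := hl (v₀ - v) v v₀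
    have h₄ := hl (v₀ - v) v v
    have h₅ := hr (v₀ - v) (v₀ - v) v
    simp only [sub_add_cancel] at h₃ h₄ h₅
    simp only [hl, hr] at h₁
    linarith
  · exact h v hv

/-- A symmetric bilinear form with vanishing diagonal vanishes. -/
lemma eq_zero_of_diag_eq_zero {f : V → V → ℝ} (hl : ∀ u v w, f (u + v) w = f u w + f v w)
    (hr : ∀ u v w, f u (v + w) = f u v + f u w) (hs : ∀ v w, f v w = f w v)
    (h : ∀ v, f v v = 0) (v w : V) : f v w = 0 := by
  have h₁ := h (v + w)
  simp only [hl, hr, h v, h w, hs w v] at h₁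
  linarith

variable [Module ℝ V]

/-- The curvature operator `D_{[X, Y]} Z - (D_X D_Y Z - D_Y D_X Z)` of a connection `D` on a module
of vector fields with bracket `B`. -/
def curv (D B : V →ₗ[ℝ] V →ₗ[ℝ] V) (X Y Z : V) : V :=
  D (B X Y) Z - (D X (D Y Z) - D Y (D X Z))

/-- The torsion operator `D_X Y - D_Y X - [X, Y]`. -/
def tors (D B : V →ₗ[ℝ] V →ₗ[ℝ] V) : V →ₗ[ℝ] V →ₗ[ℝ] V := D - D.flip - B

variable {D B : V →ₗ[ℝ] V →ₗ[ℝ] V} {J : V →ₗ[ℝ] V}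

lemma tors_apply (X Y : V) : tors D B X Y = D X Y - D Y X - B X Y := rfl

lemma bracket_eq (X Y : V) : B X Y = D X Y - D Y X - tors D B X Y := by
  rw [tors_apply]; abel

/-- The first Bianchi identity of a connection with torsion. -/
lemma curv_cyclic (hB : ∀ X Y, B X Y = - B Y X)
    (hJac : ∀ X Y Z, B X (B Y Z) = B (B X Y) Z + B Y (B X Z)) (X Y Z : V) :
    curv D B X Y Z + curv D B Y Z X + curv D B Z X Y =
      tors D B (B X Y) Z + tors D B (B Y Z) X + tors D B (B Z X) Y
        - D X (tors D B Y Z) - D Y (tors D B Z X) - D Z (tors D B X Y) := by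
  have h := hJac X Y Z
  rw [hB X (B Y Z), hB Y (B X Z), hB X Z] at h
  simp only [map_neg, LinearMap.neg_apply] at h
  simp only [curv, tors_apply, map_sub]
  linear_combination (norm := module) -h

/-- The second Bianchi identity. -/
lemma curv_bianchi (hB : ∀ X Y, B X Y = - B Y X)
    (hJac : ∀ X Y Z, B X (B Y Z) = B (B X Y) Z + B Y (B X Z)) (X Y Z W : V) :
    curv D B X (B Y Z) W + curv D B Y (B Z X) W + curv D B Z (B X Y) W
      + (D X (curv D B Y Z W) - curv D B Y Z (D X W))
      + (D Y (curv D B Z X W) - curv D B Z X (D Y W))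
      + (D Z (curv D B X Y W) - curv D B X Y (D Z W)) = 0 := by
  -- Commutators of the operators D_X satisfy Jacobi by themselves; what remains is D along the
  -- Jacobi identity of the bracket.
  have h := congrArg (fun U ↦ D U W) (hJac X Y Z)
  rw [hB (B X Y) Z, hB X Z] at h
  simp only [map_neg, map_add, LinearMap.neg_apply, LinearMap.add_apply] at h
  simp only [curv, map_sub]
  linear_combination (norm := module) h

lemma curv_comm (hDJ : ∀ X Y, D X (J Y) = J (D X Y)) (X Y Z : V) :
    curv D B X Y (J Z) = J (curv D B X Y Z) := by
  simp only [curv, hDJ, map_sub]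

lemma curv_swap (hB : ∀ X Y, B X Y = - B Y X) (X Y Z : V) :
    curv D B X Y Z = - curv D B Y X Z := by
  simp only [curv, hB X Y, map_neg, LinearMap.neg_apply]; abel

/-- For a connection that preserves an integrable `J` and whose torsion has no `(1,1)`-part, the
torsion is complex linear. -/
lemma tors_J_left (hJ : ∀ X, J (J X) = -X) (hDJ : ∀ X Y, D X (J Y) = J (D X Y))
    (h11 : ∀ X Y, tors D B X Y + tors D B (J X) (J Y) = 0)
    (hN : ∀ X Y, B (J X) (J Y) - J (B (J X) Y) - J (B X (J Y)) - B X Y = 0) (X Y : V) :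
    tors D B (J X) Y = J (tors D B X Y) := by
  have h₁ := congrArg J (h11 X Y)
  have h₂ := h11 (J X) Y
  -- As J is parallel, the derivatives cancel in N, leaving T(X, Y) - T(JX, JY) + J(T(JX, Y) + T(X,
  -- JY)) = 0.
  have h₃ := congrArg J (hN X Y)
  simp only [bracket_eq (D := D) (B := B), map_sub, hJ, hDJ, map_zero, map_neg, map_add,
    LinearMap.neg_apply] at h₁ h₂ h₃
  linear_combination (norm := module) (1 / 2 : ℝ) • (h₂ - h₁ - h₃)

lemma curv_add_left (X X' Y Z : V) :
    curv D B (X + X') Y Z = curv D B X Y Z + curv D B X' Y Z := by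
  simp only [curv, map_add, LinearMap.add_apply]; abel

lemma curv_add_mid (X Y Y' Z : V) :
    curv D B X (Y + Y') Z = curv D B X Y Z + curv D B X Y' Z := by
  simp only [curv, map_add, LinearMap.add_apply]; abel

/-- The `(0,2)`-part of the curvature vanishes on vectors of type `(1,0)`. -/
lemma curv_zero_two (hB : ∀ X Y, B X Y = - B Y X)
    (hJac : ∀ X Y Z, B X (B Y Z) = B (B X Y) Z + B Y (B X Z))
    (hJ : ∀ X, J (J X) = -X) (hDJ : ∀ X Y, D X (J Y) = J (D X Y))
    (hTl : ∀ X Y, tors D B (J X) Y = J (tors D B X Y))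
    (hTr : ∀ X Y, tors D B X (J Y) = J (tors D B X Y)) (X Y Z : V) :
    curv D B X Y Z - curv D B (J X) (J Y) Z
      + J (curv D B (J X) Y Z + curv D B X (J Y) Z) = 0 := by
  have hb (X Y Z : V) : curv D B X Y Z + curv D B Y Z X + curv D B Z X Y =
      tors D B (D X Y - D Y X - tors D B X Y) Z + tors D B (D Y Z - D Z Y - tors D B Y Z) X
        + tors D B (D Z X - D X Z - tors D B Z X) Y
        - D X (tors D B Y Z) - D Y (tors D B Z X) - D Z (tors D B X Y) := by
    rw [curv_cyclic hB hJac, ← bracket_eq, ← bracket_eq, ← bracket_eq]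
  have hR := curv_comm (D := D) (B := B) hDJ
  -- These are the terms of the first Bianchi identity on X + iJX, Y + iJY, Z - iJZ. Replacing i by
  -- J projects to type (1,0), where only R(X + iJX, Y + iJY) survives.
  have h₁ := hb X Y Z
  have h₂ := hb (J X) (J Y) Z
  have h₃ := hb (J X) Y (J Z)
  have h₄ := hb X (J Y) (J Z)
  have h₅ := congrArg J (hb (J X) Y Z)
  have h₆ := congrArg J (hb X (J Y) Z)
  have h₇ := congrArg J (hb X Y (J Z))
  have h₈ := congrArg J (hb (J X) (J Y) (J Z))
  simp only [hTl, hTr, hDJ, hJ, hR, map_add, map_sub, map_neg, LinearMap.sub_apply,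
    LinearMap.neg_apply, neg_neg] at h₁ h₂ h₃ h₄ h₅ h₆ h₇ h₈ ⊢
  generalize tors D B = T at *
  linear_combination (norm := module) (1 / 2 : ℝ) • (h₁ - h₂ + h₃ + h₄ + h₅ + h₆ - h₇ + h₈)

lemma curv_neg_mid (X Y Z : V) : curv D B X (-Y) Z = - curv D B X Y Z := by
  simp only [curv, map_neg, LinearMap.neg_apply]; abel

lemma curv_add_right (X Y Z Z' : V) :
    curv D B X Y (Z + Z') = curv D B X Y Z + curv D B X Y Z' := by
  simp only [curv, map_add]; abel

/-! ### Curvature and torsion in the presence of a Hermitian form -/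

variable {g : V →ₗ[ℝ] V →ₗ[ℝ] ℝ}

lemma inner_J_left (hJ : ∀ X, J (J X) = -X) (hgJ : ∀ X Y, g (J X) (J Y) = g X Y) (X Y : V) :
    g (J X) Y = - g X (J Y) := by
  rw [← hgJ X (J Y), hJ, map_neg, neg_neg]

/-- The curvature is of type `(1,1)`. -/
lemma inner_curv_J_J (hB : ∀ X Y, B X Y = - B Y X)
    (hJac : ∀ X Y Z, B X (B Y Z) = B (B X Y) Z + B Y (B X Z))
    (hJ : ∀ X, J (J X) = -X) (hDJ : ∀ X Y, D X (J Y) = J (D X Y))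
    (hTl : ∀ X Y, tors D B (J X) Y = J (tors D B X Y))
    (hTr : ∀ X Y, tors D B X (J Y) = J (tors D B X Y))
    (hgJ : ∀ X Y, g (J X) (J Y) = g X Y)
    (hR : ∀ X Y Z W, g (curv D B X Y Z) W = - g Z (curv D B X Y W)) (X Y Z W : V) :
    g (curv D B (J X) (J Y) Z) W = g (curv D B X Y Z) W := by
  have h := curv_zero_two hB hJac hJ hDJ hTl hTr X Y
  -- In `h`, R(X, Y) - R(JX, JY) is skew, while the J-term, a product of commuting skew operators,
  -- is symmetric; so each vanishes.
  have hZ := congrArg (fun U ↦ g U W) (h Z)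
  have hW := congrArg (fun U ↦ g Z U) (h W)
  have e₁ := hR (J X) Y Z (J W)
  have e₂ := hR X (J Y) Z (J W)
  rw [curv_comm hDJ] at e₁ e₂
  simp only [map_add, map_sub, map_zero, LinearMap.add_apply, LinearMap.sub_apply,
    LinearMap.zero_apply, inner_J_left hJ hgJ] at hZ hW
  linarith [hR X Y Z W, hR (J X) (J Y) Z W]

/-- A curvature operator of type `(1,1)` with constant bisectional curvature `c` is `c ω ⊗ J`. -/
lemma inner_curv_eq {c : ℝ} (hB : ∀ X Y, B X Y = - B Y X)
    (hJ : ∀ X, J (J X) = -X) (hDJ : ∀ X Y, D X (J Y) = J (D X Y))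
    (hg : ∀ X Y, g X Y = g Y X) (hgJ : ∀ X Y, g (J X) (J Y) = g X Y)
    (hR : ∀ X Y Z W, g (curv D B X Y Z) W = - g Z (curv D B X Y W))
    (hRJ : ∀ X Y Z W, g (curv D B (J X) (J Y) Z) W = g (curv D B X Y Z) W)
    (hc : ∀ X Y, g (curv D B X (J X) Y) (J Y) = c * (g X X * g Y Y)) (X Y Z W : V) :
    g (curv D B X Y Z) W = c * (g (J X) Y * g (J Z) W) := by
  -- Polarise in Y: the form is symmetric because R(X, JX) is skew and commutes with J.
  have h₁ (X Y W : V) : g (curv D B X (J X) Y) (J W) - c * (g X X * g Y W) = 0 := by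
    refine eq_zero_of_diag_eq_zero (f := fun Y W ↦ g (curv D B X (J X) Y) (J W)
      - c * (g X X * g Y W)) ?_ ?_ ?_ (fun Y ↦ by rw [hc, sub_self]) Y W
    · intro u v w
      simp only [curv_add_right, map_add, LinearMap.add_apply]; ring
    · intro u v w
      simp only [map_add]; ring
    · intro v w
      rw [hR, curv_comm hDJ, hg v w, hg v, inner_J_left hJ hgJ, neg_neg]
  -- Polarise in X: here symmetry is the type (1,1) of R.
  have h₂ (X Y W : V) : g (curv D B X (J Y) Z) (J W) - c * (g X Y * g Z W) = 0 := by
    refine eq_zero_of_diag_eq_zero (f := fun X Y ↦ g (curv D B X (J Y) Z) (J W)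
      - c * (g X Y * g Z W)) ?_ ?_ ?_ (fun X ↦ h₁ X Z W) X Y
    · intro u v w
      simp only [curv_add_left, map_add, LinearMap.add_apply]; ring
    · intro u v w
      simp only [curv_add_mid, map_add, LinearMap.add_apply]; ring
    · intro v w
      rw [← hRJ v, hJ, curv_neg_mid, curv_swap hB (J v), neg_neg, hg v w]
  have h₃ := h₂ X (J Y) (J W)
  simp only [hJ, curv_neg_mid, map_neg, LinearMap.neg_apply, neg_neg] at h₃
  rw [inner_J_left hJ hgJ, inner_J_left hJ hgJ]
  linarith

/-- If the curvature is `c ω ⊗ J` with `c ≠ 0`, then the second Bianchi identity shows that the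
complex linear torsion vanishes. -/
lemma inner_J_tors_eq_zero {c : ℝ} (hc : c ≠ 0) (hB : ∀ X Y, B X Y = - B Y X)
    (hJac : ∀ X Y Z, B X (B Y Z) = B (B X Y) Z + B Y (B X Z))
    (hJ : ∀ X, J (J X) = -X)
    (hTl : ∀ X Y, tors D B (J X) Y = J (tors D B X Y))
    (hTr : ∀ X Y, tors D B X (J Y) = J (tors D B X Y))
    (hg : ∀ X Y, g X Y = g Y X) (hgJ : ∀ X Y, g (J X) (J Y) = g X Y)
    (hR : ∀ X Y Z W, g (curv D B X Y Z) W = c * (g (J X) Y * g (J Z) W))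
    (hDR : ∀ X Y Z W U, g (D X (curv D B Y Z W)) U - g (curv D B Y Z (D X W)) U =
      c * ((g (J (D X Y)) Z + g (J Y) (D X Z)) * g (J W) U))
    {W : V} (hW : g W W ≠ 0) (X Y Z : V) : g (J X) (tors D B Y Z) = 0 := by
  -- This cyclic sum is dω up to sign; pairing the second Bianchi identity with JW multiplies it by
  -- c g(W, W).
  have hcyc (X Y Z : V) :
      g (J X) (tors D B Y Z) + g (J Y) (tors D B Z X) + g (J Z) (tors D B X Y) = 0 := by
    have h := congrArg (fun U ↦ g U (J W)) (curv_bianchi (D := D) hB hJac X Y Z W)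
    simp only [map_add, LinearMap.add_apply, map_sub, LinearMap.sub_apply, hDR] at h
    simp only [hR, hgJ, map_zero, LinearMap.zero_apply] at h
    have hsw (X Y : V) : g (J X) Y = - g (J Y) X := by
      rw [inner_J_left hJ hgJ, hg]
    simp only [bracket_eq (D := D) (B := B), map_sub, hsw (D _ _)] at h
    have h' : c * g W W *
        (g (J X) (tors D B Y Z) + g (J Y) (tors D B Z X) + g (J Z) (tors D B X Y)) = 0 := by
      linear_combination -h
    exact (mul_eq_zero.1 h').resolve_left (mul_ne_zero hc hW)
  have h₁ := hcyc X Y Z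
  -- By complex linearity of T, only the first term changes sign.
  have h₂ := hcyc X (J Y) (J Z)
  simp only [hTl, hTr, hJ, map_neg, LinearMap.neg_apply, inner_J_left hJ hgJ] at h₁ h₂ ⊢
  linarith

/-- A torsion free connection whose curvature is `c ω ⊗ J` is flat in complex dimension at
least two. -/
lemma eq_zero_of_inner_curv_eq {c : ℝ} (hB : ∀ X Y, B X Y = - B Y X)
    (hJac : ∀ X Y Z, B X (B Y Z) = B (B X Y) Z + B Y (B X Z))
    (hJ : ∀ X, J (J X) = -X) (hT : tors D B = 0)
    (hg : ∀ X Y, g X Y = g Y X) (hgJ : ∀ X Y, g (J X) (J Y) = g X Y)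
    (hR : ∀ X Y Z W, g (curv D B X Y Z) W = c * (g (J X) Y * g (J Z) W))
    {X Z : V} (hX : g X X ≠ 0) (hZ : g Z Z ≠ 0) (hXZ : g X Z = 0) (hJXZ : g (J X) Z = 0) :
    c = 0 := by
  have h := congrArg (fun U ↦ g U (J Z)) (curv_cyclic (D := D) hB hJac X (J X) Z)
  have hZX : g (J Z) X = 0 := by rw [inner_J_left hJ hgJ, hg, hJXZ, neg_zero]
  simp only [map_add, LinearMap.add_apply, hR, hT, LinearMap.zero_apply, map_zero, hgJ, hJ,
    map_neg, LinearMap.neg_apply, hXZ, hZX, sub_zero] at h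
  simpa [hX, hZ] using h

end Algebra

/-! ### Smooth vector fields -/

variable {E : Type*} [NormedAddCommGroup E] [NormedSpace ℝ E] [FiniteDimensional ℝ E]
  {M : Type*} [TopologicalSpace M] [ChartedSpace E M] [IsManifold 𝓘(ℝ, E) ∞ M]

local instance : IsManifold 𝓘(ℝ, E) (minSmoothness ℝ 2) M := by
  rw [minSmoothness_of_isRCLikeNormedField]; infer_instance

local instance : IsManifold 𝓘(ℝ, E) (minSmoothness ℝ 3) M := by
  rw [minSmoothness_of_isRCLikeNormedField]; infer_instance

local instance : IsManifold 𝓘(ℝ, E) (∞ + 1) M := inferInstanceAs (IsManifold 𝓘(ℝ, E) ∞ M)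

variable (E M) in
/-- The module of smooth vector fields on `M`. -/
abbrev Field := Cₛ^∞⟮𝓘(ℝ, E); E, (TangentSpace 𝓘(ℝ, E) : M → Type _)⟯

lemma Field.mdifferentiableAt (X : Field E M) (x : M) :
    MDifferentiableAt 𝓘(ℝ, E) 𝓘(ℝ, E).tangent
      (fun x ↦ (⟨x, X x⟩ : TangentBundle 𝓘(ℝ, E) M)) x :=
  X.contMDiff.mdifferentiableAt (by simp)

/-- Every tangent vector extends to a smooth vector field. -/
lemma exists_field_apply_eq [T2Space M] (x : M) (v : TangentSpace 𝓘(ℝ, E) x) :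
    ∃ X : Field E M, X x = v := by
  obtain ⟨s, hs, hvs⟩ := FiberBundle.exists_contMDiffOn_extend (k := ∞) 𝓘(ℝ, E) E v
  obtain ⟨u, hus, hu, hxu⟩ := mem_nhds_iff.1 hs
  obtain ⟨f, -, hf⟩ := (SmoothBumpFunction.nhds_basis_tsupport (I := 𝓘(ℝ, E)) x).mem_iff.1
    (hu.mem_nhds hxu)
  refine ⟨⟨_, ContMDiffOn.smul_section_of_tsupport f.contMDiff.contMDiffOn hu hf
    (hvs.mono hus)⟩, ?_⟩
  simp

/-- The Lie bracket of smooth vector fields. -/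
def bracket : Field E M →ₗ[ℝ] Field E M →ₗ[ℝ] Field E M :=
  LinearMap.mk₂ ℝ
    (fun X Y ↦ ⟨mlieBracket 𝓘(ℝ, E) X Y,
      ContDiff.mlieBracket_vectorField (m := ⊤) (n := ⊤) X.contMDiff Y.contMDiff (by simp)⟩)
    (fun X X' Y ↦ ContMDiffSection.ext fun x ↦
      mlieBracket_add_left (X.mdifferentiableAt x) (X'.mdifferentiableAt x))
    (fun c X Y ↦ ContMDiffSection.ext fun x ↦ mlieBracket_const_smul_left (X.mdifferentiableAt x))
    (fun X Y Y' ↦ ContMDiffSection.ext fun x ↦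
      mlieBracket_add_right (Y.mdifferentiableAt x) (Y'.mdifferentiableAt x))
    (fun c X Y ↦ ContMDiffSection.ext fun x ↦ mlieBracket_const_smul_right (Y.mdifferentiableAt x))

lemma bracket_apply (X Y : Field E M) (x : M) :
    bracket X Y x = mlieBracket 𝓘(ℝ, E) X Y x := rfl

lemma bracket_swap (X Y : Field E M) : bracket X Y = - bracket Y X :=
  ContMDiffSection.ext fun _ ↦ mlieBracket_swap_apply

lemma minSmoothness_two_le : minSmoothness ℝ 2 ≤ ∞ := by
  rw [minSmoothness_of_isRCLikeNormedField]; exact ENat.LEInfty.out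

lemma bracket_jacobi (X Y Z : Field E M) :
    bracket X (bracket Y Z) = bracket (bracket X Y) Z + bracket Y (bracket X Z) :=
  ContMDiffSection.ext fun _ ↦ leibniz_identity_mlieBracket_apply
    (X.contMDiff.contMDiffAt.of_le minSmoothness_two_le)
    (Y.contMDiff.contMDiffAt.of_le minSmoothness_two_le)
    (Z.contMDiff.contMDiffAt.of_le minSmoothness_two_le)

/-- The derivative of a function along a Lie bracket is the commutator of the derivatives. -/
lemma mvfderiv_bracket [T2Space M] {f : M → ℝ} (hf : ContMDiff 𝓘(ℝ, E) 𝓘(ℝ, ℝ) ∞ f)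
    (X Y : Field E M)
    (hX : MDifferentiable 𝓘(ℝ, E) 𝓘(ℝ, ℝ) fun y ↦ mvfderiv 𝓘(ℝ, E) f y (X y))
    (hY : MDifferentiable 𝓘(ℝ, E) 𝓘(ℝ, ℝ) fun y ↦ mvfderiv 𝓘(ℝ, E) f y (Y y)) (x : M) :
    mvfderiv 𝓘(ℝ, E) f x (bracket X Y x) =
      mvfderiv 𝓘(ℝ, E) (fun y ↦ mvfderiv 𝓘(ℝ, E) f y (Y y)) x (X x)
        - mvfderiv 𝓘(ℝ, E) (fun y ↦ mvfderiv 𝓘(ℝ, E) f y (X y)) x (Y x) := by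
  rcases subsingleton_or_nontrivial E with hE | hE
  · have (z : TangentSpace 𝓘(ℝ, E) x) : z = 0 := hE.elim z 0
    simp [this]
  obtain ⟨v, hv⟩ := exists_ne (0 : E)
  obtain ⟨Z, hZ⟩ := exists_field_apply_eq x (v : TangentSpace 𝓘(ℝ, E) x)
  have hfd (y : M) : MDifferentiableAt 𝓘(ℝ, E) 𝓘(ℝ, ℝ) f y := hf.mdifferentiable (by simp) y
  -- Compare the Jacobi identities for X, Y, fZ and X, Y, Z: the difference is a multiple of Z x ≠ 0
  -- whose coefficient is the claim.
  let fZ : Field E M := ⟨f • ⇑Z, hf.smul_section Z.contMDiff⟩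
  have hmul (W : Field E M) : (bracket W fZ : (x : M) → TangentSpace 𝓘(ℝ, E) x) =
      (fun y ↦ mvfderiv 𝓘(ℝ, E) f y (W y)) • ⇑Z + f • ⇑(bracket W Z) :=
    funext fun y ↦ mlieBracket_smul_right (hfd y) (Z.mdifferentiableAt y)
  have hmul₂ (U W : Field E M)
      (hW : MDifferentiable 𝓘(ℝ, E) 𝓘(ℝ, ℝ) fun y ↦ mvfderiv 𝓘(ℝ, E) f y (W y)) :
      bracket U (bracket W fZ) x =
        mvfderiv 𝓘(ℝ, E) (fun y ↦ mvfderiv 𝓘(ℝ, E) f y (W y)) x (U x) • Z x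
          + mvfderiv 𝓘(ℝ, E) f x (W x) • bracket U Z x
          + (mvfderiv 𝓘(ℝ, E) f x (U x) • bracket W Z x + f x • bracket U (bracket W Z) x) := by
    rw [bracket_apply, hmul, mlieBracket_add_right
      ((hW x).smul_section (Z.mdifferentiableAt x))
      ((hfd x).smul_section ((bracket W Z).mdifferentiableAt x)),
      mlieBracket_smul_right (hW x) (Z.mdifferentiableAt x),
      mlieBracket_smul_right (hfd x) ((bracket W Z).mdifferentiableAt x)]
    rfl
  have h := congrArg (fun s : Field E M ↦ s x) (bracket_jacobi X Y fZ)
  have h' := congrArg (fun s : Field E M ↦ s x) (bracket_jacobi X Y Z)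
  simp only [ContMDiffSection.coe_add, Pi.add_apply, hmul₂ X Y hY, hmul₂ Y X hX, hmul,
    Pi.smul_apply'] at h h'
  rw [h'] at h
  have key : (mvfderiv 𝓘(ℝ, E) f x (bracket X Y x) -
      (mvfderiv 𝓘(ℝ, E) (fun y ↦ mvfderiv 𝓘(ℝ, E) f y (Y y)) x (X x)
        - mvfderiv 𝓘(ℝ, E) (fun y ↦ mvfderiv 𝓘(ℝ, E) f y (X y)) x (Y x))) • Z x = 0 := by
    linear_combination (norm := module) -h
  exact sub_eq_zero.1 ((smul_eq_zero.1 key).resolve_right (by rw [hZ]; exact hv))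

/-- A smooth connection as an operator on smooth vector fields. -/
def nabla (D : CovariantDerivative 𝓘(ℝ, E) E (fun x : M ↦ TangentSpace 𝓘(ℝ, E) x))
    (hD : D.ContMDiffCovariantDerivative ∞) : Field E M →ₗ[ℝ] Field E M →ₗ[ℝ] Field E M :=
  LinearMap.mk₂ ℝ
    (fun X Y ↦ ⟨fun x ↦ D Y x (X x), by
      have h := hD.contMDiff.contMDiff (σ := Y) Y.contMDiff.contMDiffOn
      rw [contMDiffOn_univ] at h
      exact h.clm_bundle_apply X.contMDiff⟩)
    (fun X X' Y ↦ ContMDiffSection.ext fun x ↦ map_add (D Y x) _ _)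
    (fun c X Y ↦ ContMDiffSection.ext fun x ↦ map_smul (D Y x) _ _)
    (fun X Y Y' ↦ ContMDiffSection.ext fun x ↦ congrArg (fun A ↦ A (X x))
      (D.isCovariantDerivativeOnUniv.add (Y.mdifferentiableAt x) (Y'.mdifferentiableAt x)))
    (fun c X Y ↦ ContMDiffSection.ext fun x ↦ congrArg (fun A ↦ A (X x))
      (D.isCovariantDerivativeOnUniv.smul_const c (Y.mdifferentiableAt x)))

lemma tors_nabla_apply {D : CovariantDerivative 𝓘(ℝ, E) E (fun x : M ↦ TangentSpace 𝓘(ℝ, E) x)}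
    (hD : D.ContMDiffCovariantDerivative ∞) (X Y : Field E M) (x : M) :
    tors (nabla D hD) bracket X Y x = D.torsion x (X x) (Y x) :=
  (D.torsion_apply (X.mdifferentiableAt x) (Y.mdifferentiableAt x)).symm

/-! ### The Chern connection acting on smooth fields -/

section Hermitian

variable [RiemannianBundle (fun x : M ↦ TangentSpace 𝓘(ℝ, E) x)]
  {J : (x : M) → TangentSpace 𝓘(ℝ, E) x →L[ℝ] TangentSpace 𝓘(ℝ, E) x}
  {D : CovariantDerivative 𝓘(ℝ, E) E (fun x : M ↦ TangentSpace 𝓘(ℝ, E) x)}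

/-- The almost complex structure as an operator on smooth vector fields. -/
def complexStr (hJ : IsHermitianStructure J) : Field E M →ₗ[ℝ] Field E M where
  toFun X := ⟨applyField J X, hJ.smooth.clm_bundle_apply X.contMDiff⟩
  map_add' _ _ := ContMDiffSection.ext fun x ↦ map_add (J x) _ _
  map_smul' _ _ := ContMDiffSection.ext fun x ↦ map_smul (J x) _ _

/-- The inner product at `x` of two smooth vector fields. -/
def innerAt (x : M) : Field E M →ₗ[ℝ] Field E M →ₗ[ℝ] ℝ :=
  LinearMap.mk₂ ℝ (fun X Y ↦ inner ℝ (X x) (Y x))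
    (fun X X' Y ↦ inner_add_left (X x) (X' x) (Y x))
    (fun c X Y ↦ real_inner_smul_left (X x) (Y x) c)
    (fun X Y Y' ↦ inner_add_right (X x) (Y x) (Y' x))
    (fun c X Y ↦ real_inner_smul_right (X x) (Y x) c)

lemma innerAt_apply (x : M) (X Y : Field E M) : innerAt x X Y = inner ℝ (X x) (Y x) := rfl

lemma innerAt_self_ne_zero {x : M} {X : Field E M} : innerAt x X X ≠ 0 ↔ X x ≠ 0 := by
  rw [innerAt_apply]; exact inner_self_ne_zero

lemma complexStr_complexStr (hJ : IsHermitianStructure J) (X : Field E M) :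
    complexStr hJ (complexStr hJ X) = -X :=
  ContMDiffSection.ext fun x ↦ hJ.sq_eq_neg x (X x)

lemma innerAt_complexStr (hJ : IsHermitianStructure J) (x : M) (X Y : Field E M) :
    innerAt x (complexStr hJ X) (complexStr hJ Y) = innerAt x X Y :=
  hJ.orthogonal x (X x) (Y x)

lemma innerAt_comm (x : M) (X Y : Field E M) : innerAt x X Y = innerAt x Y X :=
  real_inner_comm (Y x) (X x)

variable [IsContMDiffRiemannianBundle 𝓘(ℝ, E) ∞ E (fun x : M ↦ TangentSpace 𝓘(ℝ, E) x)]

lemma contMDiff_innerAt (X Y : Field E M) :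
    ContMDiff 𝓘(ℝ, E) 𝓘(ℝ, ℝ) ∞ (fun x ↦ innerAt x X Y) :=
  ContMDiff.inner_bundle (F := E) (E := fun x : M ↦ TangentSpace 𝓘(ℝ, E) x) (b := id)
    X.contMDiff Y.contMDiff

lemma mdifferentiable_innerAt (X Y : Field E M) :
    MDifferentiable 𝓘(ℝ, E) 𝓘(ℝ, ℝ) (fun x ↦ innerAt x X Y) :=
  (contMDiff_innerAt X Y).mdifferentiable (by simp)

lemma mvfderiv_innerAt (hD : IsChernConnection J D) (X Y Z : Field E M) (x : M) :
    mvfderiv 𝓘(ℝ, E) (fun y ↦ innerAt y Y Z) x (X x) =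
      innerAt x (nabla D hD.smooth X Y) Z + innerAt x Y (nabla D hD.smooth X Z) :=
  hD.metric_parallel Y Z Y.contMDiff Z.contMDiff x (X x)

/-- The curvature of a metric connection is skew-symmetric. -/
lemma innerAt_curv_skew [T2Space M] (hD : IsChernConnection J D) (X Y Z W : Field E M) (x : M) :
    innerAt x (curv (nabla D hD.smooth) bracket X Y Z) W =
      - innerAt x Z (curv (nabla D hD.smooth) bracket X Y W) := by
  have h₁ (U : Field E M) : (fun y ↦ mvfderiv 𝓘(ℝ, E) (fun y ↦ innerAt y Z W) y (U y)) =
      (fun y ↦ innerAt y (nabla D hD.smooth U Z) W) +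
        fun y ↦ innerAt y Z (nabla D hD.smooth U W) :=
    funext fun y ↦ mvfderiv_innerAt hD U Z W y
  -- Metric compatibility writes the derivative as a sum of inner products of smooth fields, hence
  -- it is differentiable.
  have hm (U : Field E M) : MDifferentiable 𝓘(ℝ, E) 𝓘(ℝ, ℝ)
      fun y ↦ mvfderiv 𝓘(ℝ, E) (fun y ↦ innerAt y Z W) y (U y) := by
    rw [h₁]
    exact (mdifferentiable_innerAt _ _).add (mdifferentiable_innerAt _ _)
  have h₂ (U U' : Field E M) :
      mvfderiv 𝓘(ℝ, E) (fun y ↦ mvfderiv 𝓘(ℝ, E) (fun y ↦ innerAt y Z W) y (U y)) x (U' x) =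
      mvfderiv 𝓘(ℝ, E) (fun y ↦ innerAt y (nabla D hD.smooth U Z) W) x (U' x) +
      mvfderiv 𝓘(ℝ, E) (fun y ↦ innerAt y Z (nabla D hD.smooth U W)) x (U' x) := by
    rw [h₁, mvfderiv_add (mdifferentiable_innerAt _ _ x) (mdifferentiable_innerAt _ _ x)]
    rfl
  have h := mvfderiv_bracket (contMDiff_innerAt Z W) X Y (hm X) (hm Y) x
  rw [h₂, h₂] at h
  simp only [mvfderiv_innerAt hD] at h
  simp only [curv, map_sub, LinearMap.sub_apply]
  linear_combination h

lemma nabla_complexStr (hJ : IsHermitianStructure J) (hD : IsChernConnection J D)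
    (X Y : Field E M) :
    nabla D hD.smooth X (complexStr hJ Y) = complexStr hJ (nabla D hD.smooth X Y) :=
  ContMDiffSection.ext fun x ↦ hD.complex_parallel Y Y.contMDiff x (X x)

/-- The torsion of the Chern connection is complex linear in the first variable. -/
lemma tors_complexStr_left (hJ : IsHermitianStructure J) (hD : IsChernConnection J D)
    (X Y : Field E M) :
    tors (nabla D hD.smooth) bracket (complexStr hJ X) Y =
      complexStr hJ (tors (nabla D hD.smooth) bracket X Y) := by
  refine tors_J_left (complexStr_complexStr hJ) (nabla_complexStr hJ hD) (fun X Y ↦ ?_)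
    (fun X Y ↦ ?_) X Y
  · ext x
    rw [ContMDiffSection.coe_add, Pi.add_apply, tors_nabla_apply, tors_nabla_apply]
    exact hD.torsion_one_one x (X x) (Y x)
  · ext x
    exact hJ.nijenhuis_eq_zero X Y X.contMDiff Y.contMDiff x

/-- The torsion of the Chern connection is complex linear in the second variable. -/
lemma tors_complexStr_right (hJ : IsHermitianStructure J) (hD : IsChernConnection J D)
    (X Y : Field E M) :
    tors (nabla D hD.smooth) bracket X (complexStr hJ Y) =
      complexStr hJ (tors (nabla D hD.smooth) bracket X Y) := by
  have h (X Y : Field E M) : tors (nabla D hD.smooth) bracket X Y =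
      - tors (nabla D hD.smooth) bracket Y X := by
    rw [tors_apply, tors_apply, bracket_swap]; abel
  rw [h, tors_complexStr_left hJ hD, h Y X, map_neg, neg_neg]

variable [T2Space M]

/-- The bisectional curvature of the Chern connection as an identity of smooth fields, without
the assumption that the fields do not vanish. -/
lemma innerAt_curv_complexStr_self [Nontrivial E] {c : ℝ} (hJ : IsHermitianStructure J)
    (hD : IsChernConnection J D) (hc : HasConstantBisectionalCurvature J D c) (x : M)
    (X Y : Field E M) :
    innerAt x (curv (nabla D hD.smooth) bracket X (complexStr hJ X) Y) (complexStr hJ Y) =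
      c * (innerAt x X X * innerAt x Y Y) := by
  -- The hypothesis says nothing about fields vanishing at x; biadditivity extends the identity to
  -- them, first in Y, then in X.
  let S : AddSubgroup (Field E M) :=
    { carrier := {X | X x = 0}
      zero_mem' := rfl
      add_mem' := fun {X Y} (hX : X x = 0) (hY : Y x = 0) ↦ by
        change X x + Y x = 0
        rw [hX, hY, add_zero]
      neg_mem' := fun {X} (hX : X x = 0) ↦ by
        change -(X x) = 0
        rw [hX, neg_zero] }
  obtain ⟨v, hv⟩ := exists_ne (0 : E)
  obtain ⟨V, hV⟩ := exists_field_apply_eq x (v : TangentSpace 𝓘(ℝ, E) x)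
  have hVS : V ∉ S := fun h ↦ hv (hV.symm.trans h)
  have h₀ (X Y : Field E M) (hX : X ∉ S) (hY : Y ∉ S) :
      innerAt x (curv (nabla D hD.smooth) bracket X (complexStr hJ X) Y) (complexStr hJ Y) =
        c * (innerAt x X X * innerAt x Y Y) := by
    have h := hc X Y X.contMDiff Y.contMDiff x hX hY
    have hXn : ‖X x‖ ^ 2 = innerAt x X X := (real_inner_self_eq_norm_sq _).symm
    have hYn : ‖Y x‖ ^ 2 = innerAt x Y Y := (real_inner_self_eq_norm_sq _).symm
    rw [bisectionalCurvature, hXn, hYn, div_eq_iff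
      (mul_ne_zero (innerAt_self_ne_zero.2 hX) (innerAt_self_ne_zero.2 hY))] at h
    exact h
  have h₁ (X Y : Field E M) (hX : X ∉ S) :
      innerAt x (curv (nabla D hD.smooth) bracket X (complexStr hJ X) Y) (complexStr hJ Y) -
        c * (innerAt x X X * innerAt x Y Y) = 0 := by
    refine diag_eq_zero_of_forall_notMem (f := fun Y Y' ↦
      innerAt x (curv (nabla D hD.smooth) bracket X (complexStr hJ X) Y) (complexStr hJ Y') -
        c * (innerAt x X X * innerAt x Y Y')) ?_ ?_ hVS
        (fun Y hY ↦ sub_eq_zero.2 (h₀ X Y hX hY)) Y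
    · intro u v w
      simp only [curv_add_right, map_add, LinearMap.add_apply]; ring
    · intro u v w
      simp only [map_add]; ring
  refine sub_eq_zero.1 (diag_eq_zero_of_forall_notMem (f := fun X X' ↦
      innerAt x (curv (nabla D hD.smooth) bracket X (complexStr hJ X') Y) (complexStr hJ Y) -
        c * (innerAt x X X' * innerAt x Y Y)) ?_ ?_ hVS (fun X hX ↦ h₁ X Y hX) X)
  · intro u v w
    simp only [curv_add_left, map_add, LinearMap.add_apply]; ring
  · intro u v w
    simp only [curv_add_mid, map_add, LinearMap.add_apply]; ring

/-- If the bisectional curvature is constant, then the curvature of the Chern connection is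
`c ω ⊗ J`. -/
lemma innerAt_curv [Nontrivial E] {c : ℝ} (hJ : IsHermitianStructure J)
    (hD : IsChernConnection J D) (hc : HasConstantBisectionalCurvature J D c) (x : M)
    (X Y Z W : Field E M) :
    innerAt x (curv (nabla D hD.smooth) bracket X Y Z) W =
      c * (innerAt x (complexStr hJ X) Y * innerAt x (complexStr hJ Z) W) :=
  inner_curv_eq bracket_swap (complexStr_complexStr hJ) (nabla_complexStr hJ hD) (innerAt_comm x)
    (innerAt_complexStr hJ x) (fun X Y Z W ↦ innerAt_curv_skew hD X Y Z W x)
    (inner_curv_J_J bracket_swap bracket_jacobi (complexStr_complexStr hJ)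
      (nabla_complexStr hJ hD) (tors_complexStr_left hJ hD) (tors_complexStr_right hJ hD)
      (innerAt_complexStr hJ x) fun X Y Z W ↦ innerAt_curv_skew hD X Y Z W x)
    (innerAt_curv_complexStr_self hJ hD hc x) X Y Z W

/-- The covariant derivative of a curvature of the form `c ω ⊗ J`. -/
lemma innerAt_nabla_curv [Nontrivial E] {c : ℝ} (hJ : IsHermitianStructure J)
    (hD : IsChernConnection J D) (hc : HasConstantBisectionalCurvature J D c) (x : M)
    (X Y Z W U : Field E M) :
    innerAt x (nabla D hD.smooth X (curv (nabla D hD.smooth) bracket Y Z W)) U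
      - innerAt x (curv (nabla D hD.smooth) bracket Y Z (nabla D hD.smooth X W)) U =
    c * ((innerAt x (complexStr hJ (nabla D hD.smooth X Y)) Z
      + innerAt x (complexStr hJ Y) (nabla D hD.smooth X Z)) * innerAt x (complexStr hJ W) U) := by
  have h := mvfderiv_innerAt hD X (curv (nabla D hD.smooth) bracket Y Z W) U x
  -- The formula for R holds at every point, so it may be differentiated along X.
  have hf : (fun y ↦ innerAt y (curv (nabla D hD.smooth) bracket Y Z W) U) =
      (fun _ ↦ c) * ((fun y ↦ innerAt y (complexStr hJ Y) Z) *
        fun y ↦ innerAt y (complexStr hJ W) U) :=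
    funext fun y ↦ innerAt_curv hJ hD hc y Y Z W U
  have h₁ := mdifferentiable_innerAt (complexStr hJ Y) Z x
  have h₂ := mdifferentiable_innerAt (complexStr hJ W) U x
  rw [hf, mvfderiv_mul mdifferentiableAt_const (h₁.mul h₂), mvfderiv_mul h₁ h₂, mvfderiv_const]
    at h
  simp only [add_apply, smul_apply, smul_zero, add_zero,
    mvfderiv_innerAt hD, smul_eq_mul, nabla_complexStr hJ hD, innerAt_curv hJ hD hc] at h ⊢
  linear_combination -h

/-- A Chern connection of constant non-zero bisectional curvature is torsion free. -/
lemma tors_eq_zero [Nontrivial E] {c : ℝ} (hc₀ : c ≠ 0) (hJ : IsHermitianStructure J)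
    (hD : IsChernConnection J D) (hc : HasConstantBisectionalCurvature J D c) :
    tors (nabla D hD.smooth) bracket = (0 : Field E M →ₗ[ℝ] Field E M →ₗ[ℝ] Field E M) := by
  refine LinearMap.ext₂ fun X Y ↦ ContMDiffSection.ext fun x ↦ ?_
  obtain ⟨v, hv⟩ := exists_ne (0 : E)
  obtain ⟨V, hV⟩ := exists_field_apply_eq x (v : TangentSpace 𝓘(ℝ, E) x)
  -- With first argument J T(X, Y), the conclusion reads -‖T(X, Y)‖² = 0 at x.
  have h := inner_J_tors_eq_zero hc₀ bracket_swap bracket_jacobi (complexStr_complexStr hJ)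
    (tors_complexStr_left hJ hD) (tors_complexStr_right hJ hD) (innerAt_comm x)
    (innerAt_complexStr hJ x) (innerAt_curv hJ hD hc x) (innerAt_nabla_curv hJ hD hc x)
    (innerAt_self_ne_zero.2 (fun h ↦ hv (hV.symm.trans h)))
    (complexStr hJ (tors (nabla D hD.smooth) bracket X Y)) X Y
  rw [complexStr_complexStr, map_neg, LinearMap.neg_apply, neg_eq_zero] at h
  by_contra hne
  exact innerAt_self_ne_zero.2 hne h

end Hermitian

/-- In dimension at least three, some non-zero vector is orthogonal to two given vectors. -/
lemma exists_ne_zero_inner_eq_zero {F : Type*} [NormedAddCommGroup F] [InnerProductSpace ℝ F]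
    [FiniteDimensional ℝ F] (hF : 2 < Module.finrank ℝ F) (v w : F) :
    ∃ z : F, z ≠ 0 ∧ inner ℝ v z = 0 ∧ inner ℝ w z = 0 := by
  have h := LinearMap.ker_ne_bot_of_finrank_lt
    (f := (innerₛₗ ℝ v).prod (innerₛₗ ℝ w)) (by simpa using hF)
  obtain ⟨z, hz, hz₀⟩ := Submodule.exists_mem_ne_zero_of_ne_bot h
  have hz' := LinearMap.mem_ker.1 hz
  exact ⟨z, hz₀, congrArg Prod.fst hz', congrArg Prod.snd hz'⟩

end HermitianGeometry

end

open HermitianGeometry in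
theorem theorem8p8 {E : Type*} [NormedAddCommGroup E] [NormedSpace ℝ E] [FiniteDimensional ℝ E]
    {M : Type*} [TopologicalSpace M] [T2Space M] [Nonempty M] [ChartedSpace E M]
    [IsManifold 𝓘(ℝ, E) ∞ M]
    [RiemannianBundle (fun x : M ↦ TangentSpace 𝓘(ℝ, E) x)]
    [IsContMDiffRiemannianBundle 𝓘(ℝ, E) ∞ E (fun x : M ↦ TangentSpace 𝓘(ℝ, E) x)]
    (n : ℕ) (hn : 2 ≤ n) (hdim : Module.finrank ℝ E = 2 * n)
    (J : (x : M) → TangentSpace 𝓘(ℝ, E) x →L[ℝ] TangentSpace 𝓘(ℝ, E) x)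
    (hJ : HermitianGeometry.IsHermitianStructure J)
    (D : CovariantDerivative 𝓘(ℝ, E) E (fun x : M ↦ TangentSpace 𝓘(ℝ, E) x))
    (hD : HermitianGeometry.IsChernConnection J D) :
    ¬ ∃ c : ℝ, c ≠ 0 ∧ HermitianGeometry.HasConstantBisectionalCurvature J D c := by
  rintro ⟨c, hc₀, hc⟩
  have hE : Nontrivial E := Module.nontrivial_of_finrank_pos (R := ℝ) (by omega)
  obtain ⟨x⟩ := ‹Nonempty M›
  obtain ⟨v, hv⟩ : ∃ v : TangentSpace 𝓘(ℝ, E) x, v ≠ 0 := exists_ne (0 : E)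
  have hfin : FiniteDimensional ℝ (TangentSpace 𝓘(ℝ, E) x) :=
    inferInstanceAs (FiniteDimensional ℝ E)
  have hrank : Module.finrank ℝ (TangentSpace 𝓘(ℝ, E) x) = 2 * n := hdim
  -- This is where n ≥ 2 is essential: the real dimension exceeds 2.
  obtain ⟨z, hz, hvz, hJvz⟩ := exists_ne_zero_inner_eq_zero (by omega) v (J x v)
  obtain ⟨X, rfl⟩ := exists_field_apply_eq x v
  obtain ⟨Z, rfl⟩ := exists_field_apply_eq x z
  exact hc₀ (eq_zero_of_inner_curv_eq bracket_swap bracket_jacobi (complexStr_complexStr hJ)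
    (tors_eq_zero hc₀ hJ hD hc) (innerAt_comm x) (innerAt_complexStr hJ x)
    (innerAt_curv hJ hD hc x) (innerAt_self_ne_zero.2 hv) (innerAt_self_ne_zero.2 hz) hvz hJvz)
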